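/- Let $\mathbb{T}^2=\mathbb{R}^2/\mathbb{Z}^2$. A line field on $\mathbb{T}^2$ is a map $V$ from $\mathbb{T}^2$ to the projective line $\mathbb{P}(\mathbb{R}^2)\cong S^1$, regarded as a section of the trivial bundle $\mathbb{P}T\mathbb{T}^2=\mathbb{T}^2\times\mathbb{P}(\mathbb{R}^2)$; it is $C^{1+\alpha}$ if it is $C^1$ with $\alpha$-Hölder derivative. For a diffeomorphism $h$ of $\mathbb{T}^2$, the pushforward is $h_*V(x)=[Dh(h^{-1}(x))\,v]$, where $v$ is any nonzero vector in the line $V(h^{-1}(x))$. Let $r\ge 3$ be an integer, let $0<\alpha\le 1$, and let $W,V_1,V_2,V_3$ be $C^{1+\alpha}$ line fields on $\mathbb{T}^2$. Then for every $\varepsilon>0$ there are $C^r$ diffeomorphisms $h_1,h_2,h_3$ of $\mathbb{T}^2$, each at $C^r$ distance less than $\varepsilon$ from the identity, such that $$\{W(x)\}\cap\{(h_1)_*V_1(x)\}\cap\{(h_2)_*V_2(x)\}\cap\{(h_3)_*V_3(x)\}=\emptyset\qquad\text{for every }x\in\mathbb{T}^2 .$$ -/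

import Mathlib

open scoped NNReal LinearAlgebra.Projectivization

noncomputable section

namespace TorusLineFields

/-- The plane `ℝ²`, which is also every tangent space of the torus. -/
abbrev Plane : Type := Fin 2 → ℝ

/-- The torus `𝕋² = (ℝ/ℤ)²`. -/
abbrev Torus : Type := UnitAddTorus (Fin 2)

/-- The universal covering `ℝ² → 𝕋²`. -/
def proj (z : Plane) : Torus := fun i => (z i : UnitAddCircle)

/-- `F : ℝ² → ℝ²` is a lift of `f : 𝕋² → 𝕋²` to the universal cover. -/
def IsLift (F : Plane → Plane) (f : Torus → Torus) : Prop :=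
  ∀ z, proj (F z) = f (proj z)

/-- A map of the torus is `C^r` if it has a `C^r` lift.  (Every continuous map of the torus has a
continuous lift, any two of them differ by a constant, and the covering is a local
diffeomorphism.) -/
def IsCr (r : ℕ) (f : Torus → Torus) : Prop :=
  ∃ F : Plane → Plane, ContDiff ℝ r F ∧ IsLift F f

/-- A `C^r` diffeomorphism of the torus. -/
structure Diffeo (r : ℕ) extends Torus ≃ Torus where
  isCr_toFun : IsCr r toFun
  isCr_invFun : IsCr r invFun

theorem proj_surjective : Function.Surjective proj := by
  intro x
  choose z hz using fun i => QuotientAddGroup.mk_surjective (x i)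
  exact ⟨z, funext hz⟩

theorem proj_eq_proj_iff {z w : Plane} :
    proj z = proj w ↔ ∀ i, ∃ n : ℤ, w i = z i + n := by
  simp only [proj, funext_iff]
  refine forall_congr' fun i => ?_
  rw [← sub_eq_zero, ← AddCircle.coe_sub, AddCircle.coe_eq_zero_iff]
  constructor
  · rintro ⟨n, hn⟩
    exact ⟨-n, by simp at hn ⊢; linarith⟩
  · rintro ⟨n, hn⟩
    exact ⟨-n, by simp; linarith⟩

/-- Two continuous maps into the plane with the same projection to the torus differ by a constant. -/
theorem sub_const_of_proj_eq {F G : Plane → Plane} (hF : Continuous F) (hG : Continuous G)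
    (h : ∀ z, proj (F z) = proj (G z)) : ∃ c : Plane, ∀ z, G z = F z + c := by
  refine ⟨G 0 - F 0, fun z => ?_⟩
  funext i
  choose n hn using fun z => proj_eq_proj_iff.1 (h z) i
  have hc : Continuous fun z => (n z : ℝ) := by
    have : (fun z => (n z : ℝ)) = fun z => G z i - F z i := by
      funext z; rw [hn z]; ring
    rw [this]; fun_prop
  have hn' : Continuous n := Int.isClosedEmbedding_coe_real.isEmbedding.continuous_iff.2 hc
  have := PreconnectedSpace.constant inferInstance hn' (x := z) (y := 0)
  simp only [Pi.add_apply, Pi.sub_apply]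
  rw [hn z, hn 0, this]; ring

/-- The differential computed through a lift depends neither on the lift nor on the point over
`x`. -/
theorem fderiv_lift_eq {f : Torus → Torus} {F G : Plane → Plane} (hF : Continuous F)
    (hG : Continuous G) (hFf : IsLift F f) (hGf : IsLift G f) {z w : Plane}
    (hzw : proj z = proj w) : fderiv ℝ F z = fderiv ℝ G w := by
  have key : ∀ y, proj y = proj (y + (w - z)) := fun y => by
    rw [proj_eq_proj_iff] at hzw ⊢
    intro i
    obtain ⟨n, hn⟩ := hzw i
    exact ⟨n, by simp [hn]⟩
  obtain ⟨c, hc⟩ := sub_const_of_proj_eq hF (G := fun y => G (y + (w - z))) (by fun_prop)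
    (fun y => by rw [hFf, hGf, ← key])
  have h1 : fderiv ℝ (fun y => G (y + (w - z))) z = fderiv ℝ G w := by
    rw [fderiv_comp_add_right]; simp
  rw [← h1, funext hc, fderiv_add_const]

namespace Diffeo

variable {r : ℕ}

/-- The differential `Dh(x) : T_x𝕋² = ℝ² → ℝ² = T_{h(x)}𝕋²`, computed through any `C^r` lift at any
point over `x`. -/
def deriv (h : Diffeo r) (x : Torus) : Plane →L[ℝ] Plane :=
  fderiv ℝ h.isCr_toFun.choose (proj_surjective x).choose

theorem deriv_eq (h : Diffeo r) {F : Plane → Plane} (hF : Continuous F) (hFh : IsLift F h.toFun)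
    (z : Plane) : h.deriv (proj z) = fderiv ℝ F z :=
  fderiv_lift_eq h.isCr_toFun.choose_spec.1.continuous hF h.isCr_toFun.choose_spec.2 hFh
    (proj_surjective (proj z)).choose_spec

theorem deriv_injective (hr : r ≠ 0) (h : Diffeo r) (x : Torus) :
    Function.Injective (h.deriv x) := by
  obtain ⟨z, rfl⟩ := proj_surjective x
  obtain ⟨F, hF, hFh⟩ := h.isCr_toFun
  obtain ⟨G, hG, hGh⟩ := h.isCr_invFun
  rw [h.deriv_eq hF.continuous hFh]
  obtain ⟨c, hc⟩ := sub_const_of_proj_eq continuous_id (hG.continuous.comp hF.continuous)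
    (fun y => by
      rw [Function.comp_apply, hGh, hFh]
      exact (h.left_inv _).symm)
  have hr' : (r : WithTop ℕ∞) ≠ 0 := by exact_mod_cast hr
  have h1 : fderiv ℝ (G ∘ F) z = ContinuousLinearMap.id ℝ Plane := by
    rw [funext hc]; simp [fderiv_add_const]
  rw [fderiv_comp z (hG.differentiable hr' _) (hF.differentiable hr' _)] at h1
  exact Function.LeftInverse.injective (g := fderiv ℝ G (F z)) fun v => by
    simpa using congrArg (fun L : Plane →L[ℝ] Plane => L v) h1

/-- The pushforward `(h_*V)(x) = [Dh(h⁻¹(x)) v]`, where `v` spans `V(h⁻¹(x))`. -/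
def pushforward (hr : r ≠ 0) (h : Diffeo r) (V : Torus → ℙ ℝ Plane) (x : Torus) : ℙ ℝ Plane :=
  Projectivization.map (h.deriv (h.invFun x)).toLinearMap (h.deriv_injective hr _) (V (h.invFun x))

/-- `h` is at `C^r` distance less than `ε` from the identity: some lift `H` of `h` satisfies
`‖Dᵏ(H - id)‖ < ε` everywhere for all `0 ≤ k ≤ r`. -/
def IsCloseToId (h : Diffeo r) (ε : ℝ) : Prop :=
  ∃ H : Plane → Plane, ContDiff ℝ r H ∧ IsLift H h.toFun ∧
    ∀ k ≤ r, ∀ z, ‖iteratedFDeriv ℝ k (fun y => H y - y) z‖ < ε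

end Diffeo

/-- The line in `ℝ²` that makes the angle `t` with the first axis; it depends on `t` modulo `π`, and
this identifies the projective line with the circle `ℝ/πℤ`. -/
def lineOfAngle (t : ℝ) : ℙ ℝ Plane :=
  Projectivization.mk ℝ ![Real.cos t, Real.sin t] (fun h => by
    have h0 : Real.cos t = 0 := congrFun h 0
    have h1 : Real.sin t = 0 := congrFun h 1
    have := Real.sin_sq_add_cos_sq t
    simp [h0, h1] at this)

/-- `V` is a `C^{1+α}` line field on the torus: its angle, lifted to a real function on the universal
cover, is `C¹` with `α`-Hölder differential.  The angle is only defined modulo `π`, so it need not be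
periodic, and `V` need not be orientable. -/
def IsC1HolderLineField (α : ℝ≥0) (V : Torus → ℙ ℝ Plane) : Prop :=
  ∃ θ : Plane → ℝ, ContDiff ℝ 1 θ ∧ (∃ C : ℝ≥0, HolderWith C α (fderiv ℝ θ)) ∧
    ∀ z, V (proj z) = lineOfAngle (θ z)

end TorusLineFields

end

namespace TorusLineFields

open MeasureTheory Set Filter Topology ContDiff

section Avoidance

theorem mul_abs_sub_le_of_le_abs_deriv {g : ℝ → ℝ} (hg : Differentiable ℝ g) {c δ : ℝ}
    (h : ∀ t, |t| ≤ δ → c ≤ |deriv g t|) {s t : ℝ} (hs : |s| ≤ δ) (ht : |t| ≤ δ) :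
    c * |t - s| ≤ |g t - g s| := by
  wlog hst : s < t generalizing s t
  · rcases (not_lt.1 hst).lt_or_eq with hlt | rfl
    · rw [abs_sub_comm t, abs_sub_comm (g t)]
      exact this ht hs hlt
    · simp
  obtain ⟨u, hu, hd⟩ := exists_deriv_eq_slope g hst hg.continuous.continuousOn
    hg.differentiableOn
  have hu' : |u| ≤ δ := by
    rw [abs_le] at *
    exact ⟨hs.1.trans hu.1.le, hu.2.le.trans ht.2⟩
  have hc := h u hu'
  rw [hd, abs_div, le_div_iff₀ (abs_pos.2 (sub_pos.2 hst).ne')] at hc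
  exact hc

theorem volume_sublevel_le {n : ℕ} {f : (Fin (n + 1) → ℝ) → ℝ} (hf : Differentiable ℝ f)
    (j : Fin (n + 1)) {c δ η : ℝ} (hc : 0 < c) (hδ : 0 ≤ δ)
    (h : ∀ p, ‖p‖ ≤ δ → c ≤ |fderiv ℝ f p (Pi.single j 1)|) :
    volume {p | ‖p‖ ≤ δ ∧ |f p| ≤ η} ≤ ENNReal.ofReal (2 * η / c * (2 * δ) ^ n) := by
  rcases lt_or_ge η 0 with hη | hη
  · have : {p | ‖p‖ ≤ δ ∧ |f p| ≤ η} = ∅ := by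
      ext p
      simp only [mem_ofPred_eq, mem_empty_iff_false, iff_false, not_and, not_le]
      exact fun _ => hη.trans_le (abs_nonneg _)
    rw [this]
    simp
  have hmeas : MeasurableSet {p | ‖p‖ ≤ δ ∧ |f p| ≤ η} := by
    refine IsClosed.measurableSet ?_
    exact (isClosed_le continuous_norm continuous_const).inter
      (isClosed_le hf.continuous.abs continuous_const)
  have hmp := (volume_preserving_piFinSuccAbove (fun _ : Fin (n + 1) => ℝ) j).symm
  rw [← hmp.measure_preimage hmeas.nullMeasurableSet]
  have hnorm : ∀ (t : ℝ) (q : Fin n → ℝ),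
      ‖(j.insertNth t q : Fin (n + 1) → ℝ)‖ ≤ δ ↔ |t| ≤ δ ∧ ‖q‖ ≤ δ := by
    intro t q
    rw [pi_norm_le_iff_of_nonneg hδ, pi_norm_le_iff_of_nonneg hδ, Fin.forall_iff_succAbove j]
    simp
  change (volume.prod volume) _ ≤ _
  rw [Measure.prod_apply_symm (hmp.measurable hmeas)]
  have hslice : ∀ q : Fin n → ℝ,
      volume ((fun t => (t, q)) ⁻¹' ((MeasurableEquiv.piFinSuccAbove (fun _ => ℝ) j).symm ⁻¹'
        {p | ‖p‖ ≤ δ ∧ |f p| ≤ η})) ≤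
      (Metric.closedBall (0 : Fin n → ℝ) δ).indicator (fun _ => ENNReal.ofReal (2 * η / c)) q := by
    intro q
    have hset : ((fun t : ℝ => (t, q)) ⁻¹' ((MeasurableEquiv.piFinSuccAbove (fun _ => ℝ) j).symm ⁻¹'
        {p | ‖p‖ ≤ δ ∧ |f p| ≤ η})) =
        {t : ℝ | (|t| ≤ δ ∧ ‖q‖ ≤ δ) ∧ |f (j.insertNth t q)| ≤ η} := by
      ext t
      simp only [mem_preimage, mem_ofPred_eq, ← hnorm]
      rfl
    rw [hset]
    by_cases hq : ‖q‖ ≤ δ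
    · rw [indicator_of_mem (by simpa using hq)]
      refine (Real.volume_le_diam _).trans (Metric.ediam_le fun t ht s hs => ?_)
      have hline : ∀ t : ℝ, HasDerivAt (fun t : ℝ => (j.insertNth t q : Fin (n + 1) → ℝ))
          (Pi.single j 1) t := by
        intro t
        rw [hasDerivAt_pi]
        intro i
        refine Fin.succAboveCases j ?_ (fun i => ?_) i
        · simpa using hasDerivAt_id' t
        · simpa using hasDerivAt_const t (q i)
      have hd : ∀ t : ℝ, HasDerivAt (fun t => f (j.insertNth t q))
          (fderiv ℝ f (j.insertNth t q) (Pi.single j 1)) t := fun t =>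
        (hf _).hasFDerivAt.comp_hasDerivAt t (hline t)
      have := mul_abs_sub_le_of_le_abs_deriv (fun t => (hd t).differentiableAt) (c := c)
        (δ := δ) (fun t ht => by rw [(hd t).deriv]; exact h _ ((hnorm t q).2 ⟨ht, hq⟩))
        hs.1.1 ht.1.1
      rw [edist_dist, Real.dist_eq]
      refine ENNReal.ofReal_le_ofReal ?_
      rw [le_div_iff₀ hc, mul_comm]
      refine this.trans ((abs_sub _ _).trans ?_)
      linarith [ht.2, hs.2]
    · have : {t : ℝ | (|t| ≤ δ ∧ ‖q‖ ≤ δ) ∧ |f (j.insertNth t q)| ≤ η} = ∅ := by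
        ext t; simp [hq]
      rw [this]; simp
  refine (lintegral_mono hslice).trans ?_
  rw [lintegral_indicator Metric.isClosed_closedBall.measurableSet, lintegral_const,
    Measure.restrict_apply_univ, Real.volume_pi_closedBall _ hδ, ← ENNReal.ofReal_mul (by positivity)]
  simp

/-- For parameters of norm at most `δ`, either `f (z, ·)` is bounded away from zero or one of its
partial derivatives is. -/
def UniformlyNondegenerateAt {n : ℕ} (f : Plane × (Fin n → ℝ) → ℝ) (δ : ℝ) (z : Plane) : Prop :=
  (∀ p : Fin n → ℝ, ‖p‖ ≤ δ → δ ≤ |f (z, p)|) ∨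
    ∃ j, ∀ p : Fin n → ℝ, ‖p‖ ≤ δ → δ ≤ |fderiv ℝ f (z, p) (0, Pi.single j 1)|

theorem eventually_le_abs_of_ne_zero {n : ℕ} {g : Plane × (Fin n → ℝ) → ℝ} (hg : Continuous g)
    {z : Plane} (h : g (z, 0) ≠ 0) :
    ∃ t ∈ 𝓝 z, ∀ᶠ δ in 𝓝[>] (0 : ℝ), ∀ w ∈ t, ∀ p : Fin n → ℝ, ‖p‖ ≤ δ → δ ≤ |g (w, p)| := by
  have hpos : 0 < |g (z, 0)| := abs_pos.2 h
  have hev : ∀ᶠ x in 𝓝 (z, (0 : Fin n → ℝ)), |g (z, 0)| / 2 < |g x| :=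
    hg.abs.continuousAt.eventually_const_lt (by linarith)
  obtain ⟨ρ, hρ, hball⟩ := Metric.eventually_nhds_iff.1 hev
  refine ⟨Metric.ball z ρ, Metric.ball_mem_nhds z hρ, ?_⟩
  filter_upwards [Ioo_mem_nhdsGT (show 0 < min ρ (|g (z, 0)| / 2) by positivity)]
    with δ hδ w hw p hp
  have hδ' := lt_min_iff.1 hδ.2
  refine hδ'.2.le.trans (hball ?_).le
  rw [Prod.dist_eq, max_lt_iff]
  exact ⟨hw, by simpa using hp.trans_lt hδ'.1⟩

theorem eventually_uniformlyNondegenerateAt {n : ℕ} {f : Plane × (Fin n → ℝ) → ℝ}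
    (hf : ContDiff ℝ 1 f) {K : Set Plane} (hK : IsCompact K)
    (h : ∀ z ∈ K, f (z, 0) = 0 → ∃ j, fderiv ℝ f (z, 0) (0, Pi.single j 1) ≠ 0) :
    ∀ᶠ δ in 𝓝[>] (0 : ℝ), ∀ z ∈ K, UniformlyNondegenerateAt f δ z := by
  refine hK.induction_on (p := fun s => ∀ᶠ δ in 𝓝[>] (0 : ℝ), ∀ z ∈ s,
    UniformlyNondegenerateAt f δ z) (by simp) ?_ ?_ ?_
  · intro s t hst ht
    filter_upwards [ht] with δ hδ z hz using hδ z (hst hz)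
  · intro s t hs ht
    filter_upwards [hs, ht] with δ hδ hδ' z hz using hz.elim (hδ z) (hδ' z)
  · intro z hz
    by_cases h0 : f (z, 0) = 0
    · obtain ⟨j, hj⟩ := h z hz h0
      obtain ⟨t, ht, hev⟩ := eventually_le_abs_of_ne_zero
        (g := fun x => fderiv ℝ f x (0, Pi.single j 1))
        ((hf.continuous_fderiv one_ne_zero).clm_apply continuous_const) hj
      refine ⟨t, mem_nhdsWithin_of_mem_nhds ht, ?_⟩
      filter_upwards [hev] with δ hδ w hw using Or.inr ⟨j, hδ w hw⟩
    · obtain ⟨t, ht, hev⟩ := eventually_le_abs_of_ne_zero hf.continuous h0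
      refine ⟨t, mem_nhdsWithin_of_mem_nhds ht, ?_⟩
      filter_upwards [hev] with δ hδ w hw using Or.inl (hδ w hw)

theorem UniformlyNondegenerateAt.volume_sublevel_le {n : ℕ} {f : Plane × (Fin (n + 1) → ℝ) → ℝ}
    {δ : ℝ} {z : Plane} (h : UniformlyNondegenerateAt f δ z) (hf : ContDiff ℝ 1 f) (hδ : 0 < δ)
    {η : ℝ} (hηδ : η < δ) :
    volume {p | ‖p‖ ≤ δ ∧ |f (z, p)| ≤ η} ≤ ENNReal.ofReal (2 * η / δ * (2 * δ) ^ n) := by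
  rcases h with h | ⟨j, h⟩
  · have : {p | ‖p‖ ≤ δ ∧ |f (z, p)| ≤ η} = ∅ := by
      ext p
      simp only [mem_ofPred_eq, mem_empty_iff_false, iff_false, not_and, not_le]
      exact fun hp => hηδ.trans_le (h p hp)
    rw [this]
    simp
  · have hd : ∀ p, HasFDerivAt (fun p => f (z, p))
        ((fderiv ℝ f (z, p)).comp (ContinuousLinearMap.inr ℝ Plane (Fin (n + 1) → ℝ))) p :=
      fun p => (hf.differentiable one_ne_zero _).hasFDerivAt.comp p (hasFDerivAt_prodMk_right z p)
    refine TorusLineFields.volume_sublevel_le (fun p => (hd p).differentiableAt) j hδ hδ.le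
      fun p hp => ?_
    rw [(hd p).fderiv]
    simpa using h p hp

theorem exists_grid_point_dist_le {N : ℕ} (hN : 0 < N) {z : Plane} (hz : z ∈ Icc (0 : Plane) 1) :
    ∃ k : Fin 2 → Fin (N + 1), dist z (fun i => ((k i : ℕ) : ℝ) / N) ≤ 1 / N := by
  have hN' : (0 : ℝ) < N := by exact_mod_cast hN
  have hle : ∀ i, ⌊(N : ℝ) * z i⌋₊ < N + 1 := fun i => by
    rw [Nat.lt_add_one_iff]
    refine Nat.floor_le_of_le ?_
    have : z i ≤ 1 := hz.2 i
    nlinarith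
  refine ⟨fun i => ⟨_, hle i⟩, (dist_pi_le_iff (by positivity)).2 fun i => ?_⟩
  have h0 : 0 ≤ z i := hz.1 i
  have h1 := Nat.floor_le (mul_nonneg hN'.le h0)
  have h2 := Nat.lt_floor_add_one ((N : ℝ) * z i)
  have : z i - (⌊(N : ℝ) * z i⌋₊ : ℝ) / N = (N * z i - ⌊(N : ℝ) * z i⌋₊) / N := by field_simp
  rw [Real.dist_eq, this, abs_div, abs_of_pos hN', abs_of_nonneg (by linarith)]
  gcongr
  linarith

theorem grid_mem_Icc {N : ℕ} (k : Fin 2 → Fin (N + 1)) :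
    (fun i => ((k i : ℕ) : ℝ) / N) ∈ Icc (0 : Plane) 1 := by
  refine ⟨fun i => by simp only [Pi.zero_apply]; positivity, fun i => ?_⟩
  refine div_le_one_of_le₀ ?_ (by positivity)
  exact Nat.cast_le.2 (Nat.lt_add_one_iff.1 (k i).2)

theorem exists_grid_size {A B L δ : ℝ} (hB : 0 < B) (hδ : 0 < δ) :
    ∃ N : ℕ, 0 < N ∧ L / N < δ ∧ ((N : ℝ) + 1) ^ 2 * (A * (L / N)) ^ 3 < B := by
  have h1 : Tendsto (fun N : ℕ => L / N) atTop (𝓝 0) := tendsto_const_div_atTop_nhds_zero_nat L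
  have h2 : Tendsto (fun N : ℕ => (1 + 1 / (N : ℝ)) ^ 2 * (A ^ 3 * L ^ 2 * (L / N))) atTop
      (𝓝 ((1 + 0) ^ 2 * (A ^ 3 * L ^ 2 * 0))) :=
    ((tendsto_const_nhds.add (tendsto_const_div_atTop_nhds_zero_nat 1)).pow 2).mul
      (tendsto_const_nhds.mul h1)
  simp only [mul_zero] at h2
  obtain ⟨N, hN1, hN2, hN⟩ := ((h1.eventually_lt_const hδ).and
    ((h2.eventually_lt_const hB).and (eventually_gt_atTop 0))).exists
  refine ⟨N, hN, hN1, lt_of_eq_of_lt ?_ hN2⟩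
  have : (N : ℝ) ≠ 0 := by exact_mod_cast hN.ne'
  field_simp

/-- Three functions on the unit square, each depending on its own parameters in a
nondegenerate way, have no common zero for suitable small parameters. -/
theorem exists_small_params_no_common_zero {n : ℕ}
    {f : Fin 3 → Plane × (Fin (n + 1) → ℝ) → ℝ} (hf : ∀ i, ContDiff ℝ 1 (f i))
    (h : ∀ i, ∀ z ∈ Icc (0 : Plane) 1, f i (z, 0) = 0 →
      ∃ j, fderiv ℝ (f i) (z, 0) (0, Pi.single j 1) ≠ 0) {ρ : ℝ} (hρ : 0 < ρ) :
    ∃ p : Fin 3 → Fin (n + 1) → ℝ, (∀ i, ‖p i‖ < ρ) ∧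
      ∀ z ∈ Icc (0 : Plane) 1, ∃ i, f i (z, p i) ≠ 0 := by
  have hev : ∀ᶠ δ in 𝓝[>] (0 : ℝ), ∀ i, ∀ z ∈ Icc (0 : Plane) 1,
      UniformlyNondegenerateAt (f i) δ z :=
    eventually_all.2 fun i => eventually_uniformlyNondegenerateAt (hf i) isCompact_Icc (h i)
  obtain ⟨δ, hδ, hδ0, hδρ⟩ := (hev.and (Ioo_mem_nhdsGT hρ)).exists
  have hlip : ∀ i, ∃ K, LipschitzOnWith K (f i)
      (Icc (0 : Plane) 1 ×ˢ Metric.closedBall (0 : Fin (n + 1) → ℝ) δ) := fun i =>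
    (hf i).contDiffOn.exists_lipschitzOnWith one_ne_zero
      ((convex_Icc _ _).prod (convex_closedBall _ _))
      (isCompact_Icc.prod (isCompact_closedBall _ _))
  choose K hK using hlip
  obtain ⟨N, hN, hNδ, hNB⟩ := exists_grid_size (A := 2 / δ * (2 * δ) ^ n)
    (B := ((2 * δ) ^ (n + 1)) ^ 3) (L := ((∑ i, K i : ℝ≥0) : ℝ)) (by positivity) hδ0
  set L : ℝ := ((∑ i, K i : ℝ≥0) : ℝ) with hL
  have hL0 : 0 ≤ L := NNReal.coe_nonneg _
  let grid : (Fin 2 → Fin (N + 1)) → Plane := fun k i => ((k i : ℕ) : ℝ) / N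
  let S : (Fin 2 → Fin (N + 1)) → Fin 3 → Set (Fin (n + 1) → ℝ) :=
    fun k i => {p | ‖p‖ ≤ δ ∧ |f i (grid k, p)| ≤ L / N}
  have hS : ∀ k i, volume (S k i) ≤ ENNReal.ofReal (2 / δ * (2 * δ) ^ n * (L / N)) := fun k i => by
    refine ((hδ i _ (grid_mem_Icc k)).volume_sublevel_le (hf i) hδ0 hNδ).trans_eq ?_
    congr 1
    ring
  have hlt : volume (⋃ k ∈ (Finset.univ : Finset (Fin 2 → Fin (N + 1))), univ.pi (S k)) <
      volume (univ.pi fun _ : Fin 3 => Metric.closedBall (0 : Fin (n + 1) → ℝ) δ) := by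
    calc volume (⋃ k ∈ (Finset.univ : Finset (Fin 2 → Fin (N + 1))), univ.pi (S k))
        ≤ ∑ k : Fin 2 → Fin (N + 1), volume (univ.pi (S k)) := measure_biUnion_finset_le _ _
      _ ≤ ∑ _k : Fin 2 → Fin (N + 1),
            ENNReal.ofReal (2 / δ * (2 * δ) ^ n * (L / N)) ^ 3 := by
          refine Finset.sum_le_sum fun k _ => ?_
          rw [volume_pi_pi]
          refine (Finset.prod_le_prod' fun i _ => hS k i).trans_eq ?_
          simp
      _ = ENNReal.ofReal (((N : ℝ) + 1) ^ 2 * (2 / δ * (2 * δ) ^ n * (L / N)) ^ 3) := by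
          rw [ENNReal.ofReal_mul (p := ((N : ℝ) + 1) ^ 2) (by positivity),
            ENNReal.ofReal_pow (p := (N : ℝ) + 1) (by positivity),
            ENNReal.ofReal_pow (by positivity), ENNReal.ofReal_add (by positivity) zero_le_one]
          simp
      _ < ENNReal.ofReal (((2 * δ) ^ (n + 1)) ^ 3) :=
          (ENNReal.ofReal_lt_ofReal_iff (by positivity)).2 hNB
      _ = _ := by
          rw [volume_pi_pi]
          simp only [Real.volume_pi_closedBall _ hδ0.le]
          rw [ENNReal.ofReal_pow (by positivity)]
          simp
  obtain ⟨p, hp, hpS⟩ := not_subset.1 fun hsub => (measure_mono hsub).not_gt hlt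
  have hpδ : ∀ i, ‖p i‖ ≤ δ := fun i => by simpa using hp i (mem_univ i)
  refine ⟨p, fun i => (hpδ i).trans_lt hδρ, fun z hz => ?_⟩
  obtain ⟨k, hk⟩ := exists_grid_point_dist_le hN hz
  have hkS : ¬ ∀ i, p i ∈ S k i := fun hall =>
    hpS (mem_biUnion (Finset.mem_coe.2 (Finset.mem_univ k)) fun i _ => hall i)
  obtain ⟨i, hi⟩ := not_forall.1 hkS
  refine ⟨i, fun h0 => hi ⟨hpδ i, ?_⟩⟩
  have hd := (hK i).dist_le_mul (grid k, p i) ⟨grid_mem_Icc k, by simpa using hpδ i⟩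
    (z, p i) ⟨hz, by simpa using hpδ i⟩
  rw [h0, Real.dist_eq, sub_zero] at hd
  refine hd.trans ?_
  have hKL : (K i : ℝ) ≤ L := by
    rw [hL, NNReal.coe_le_coe]
    exact Finset.single_le_sum (f := K) (fun _ _ => zero_le) (Finset.mem_univ i)
  have hdist : dist (grid k, p i) (z, p i) ≤ 1 / N := by
    rw [Prod.dist_eq, dist_self, dist_comm]
    exact max_le hk (by positivity)
  calc (K i : ℝ) * dist (grid k, p i) (z, p i) ≤ L * (1 / N) := by gcongr
    _ = L / N := by ring

end Avoidance

section Shears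

/-- The trigonometric polynomial `a sin (2πt) + b cos (2πt)`. -/
noncomputable def wave (a b t : ℝ) : ℝ :=
  a * Real.sin (2 * Real.pi * t) + b * Real.cos (2 * Real.pi * t)

/-- The derivative of `wave a b`. -/
noncomputable def waveSlope (a b t : ℝ) : ℝ :=
  2 * Real.pi * (a * Real.cos (2 * Real.pi * t) - b * Real.sin (2 * Real.pi * t))

theorem hasDerivAt_wave (a b t : ℝ) : HasDerivAt (wave a b) (waveSlope a b t) t := by
  have h : HasDerivAt (fun t : ℝ => 2 * Real.pi * t) (2 * Real.pi) t := by
    simpa using (hasDerivAt_id t).const_mul (2 * Real.pi)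
  have := (h.sin.const_mul a).add (h.cos.const_mul b)
  refine this.congr_deriv ?_
  simp only [waveSlope]
  ring

theorem wave_add_int (a b t : ℝ) (n : ℤ) : wave a b (t + n) = wave a b t := by
  have : 2 * Real.pi * (t + n) = 2 * Real.pi * t + n * (2 * Real.pi) := by ring
  simp only [wave, this, Real.sin_add_int_mul_two_pi, Real.cos_add_int_mul_two_pi]

theorem wave_zero (t : ℝ) : wave 0 0 t = 0 := by simp [wave]

theorem waveSlope_zero (t : ℝ) : waveSlope 0 0 t = 0 := by simp [waveSlope]

/-- A vertical shear followed by a horizontal one, with profiles given by the parameters. -/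
noncomputable def shear (p : Fin 4 → ℝ) (z : Plane) : Plane :=
  ![z 0 + wave (p 2) (p 3) (z 1 + wave (p 0) (p 1) (z 0)), z 1 + wave (p 0) (p 1) (z 0)]

/-- The inverse of `shear p`. -/
noncomputable def unshear (p : Fin 4 → ℝ) (z : Plane) : Plane :=
  ![z 0 - wave (p 2) (p 3) (z 1), z 1 - wave (p 0) (p 1) (z 0 - wave (p 2) (p 3) (z 1))]

theorem shear_unshear (p : Fin 4 → ℝ) (z : Plane) : shear p (unshear p z) = z := by
  ext i
  fin_cases i <;> simp [shear, unshear]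

theorem unshear_shear (p : Fin 4 → ℝ) (z : Plane) : unshear p (shear p z) = z := by
  ext i
  fin_cases i <;> simp [shear, unshear]

theorem shear_add_int (p : Fin 4 → ℝ) (z : Plane) (m : Fin 2 → ℤ) :
    shear p (z + fun i => (m i : ℝ)) = shear p z + fun i => (m i : ℝ) := by
  have h : z 1 + m 1 + wave (p 0) (p 1) (z 0) = z 1 + wave (p 0) (p 1) (z 0) + m 1 := by ring
  ext i
  fin_cases i
  · simp [shear, wave_add_int, h]; ring
  · simp [shear, wave_add_int, h]

theorem unshear_add_int (p : Fin 4 → ℝ) (z : Plane) (m : Fin 2 → ℤ) :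
    unshear p (z + fun i => (m i : ℝ)) = unshear p z + fun i => (m i : ℝ) := by
  have h : z 0 + m 0 - wave (p 2) (p 3) (z 1) = z 0 - wave (p 2) (p 3) (z 1) + m 0 := by ring
  ext i
  fin_cases i
  · simp [unshear, wave_add_int, h]
  · simp [unshear, wave_add_int, h]; ring

theorem contDiff_shear_uncurry {n : WithTop ℕ∞} :
    ContDiff ℝ n (fun x : Plane × (Fin 4 → ℝ) => shear x.2 x.1) := by
  rw [contDiff_pi]
  intro i
  fin_cases i <;> simp [shear, wave] <;> fun_prop

theorem contDiff_unshear_uncurry {n : WithTop ℕ∞} :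
    ContDiff ℝ n (fun x : (Fin 4 → ℝ) × Plane => unshear x.1 x.2) := by
  rw [contDiff_pi]
  intro i
  fin_cases i <;> simp [unshear, wave] <;> fun_prop

theorem contDiff_shear {n : WithTop ℕ∞} (p : Fin 4 → ℝ) : ContDiff ℝ n (shear p) :=
  contDiff_shear_uncurry.comp (contDiff_id.prodMk contDiff_const)

theorem contDiff_unshear {n : WithTop ℕ∞} (p : Fin 4 → ℝ) : ContDiff ℝ n (unshear p) :=
  contDiff_unshear_uncurry.comp (contDiff_const.prodMk contDiff_id)

theorem fderiv_unshear_apply (p : Fin 4 → ℝ) (z v : Plane) :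
    fderiv ℝ (unshear p) z v =
      ![v 0 - waveSlope (p 2) (p 3) (z 1) * v 1,
        v 1 - waveSlope (p 0) (p 1) (z 0 - wave (p 2) (p 3) (z 1)) *
          (v 0 - waveSlope (p 2) (p 3) (z 1) * v 1)] := by
  have hline : ∀ i, HasDerivAt (fun t : ℝ => z i + t * v i) (v i) 0 := fun i => by
    simpa using ((hasDerivAt_id (0 : ℝ)).mul_const (v i)).const_add (z i)
  have hw : HasDerivAt (fun t : ℝ => wave (p 2) (p 3) (z 1 + t * v 1))
      (waveSlope (p 2) (p 3) (z 1) * v 1) 0 := by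
    refine HasDerivAt.comp (h₂ := wave (p 2) (p 3)) (h := fun t : ℝ => z 1 + t * v 1) 0 ?_ (hline 1)
    simpa using hasDerivAt_wave (p 2) (p 3) (z 1)
  have hx := (hline 0).sub hw
  have hw' : HasDerivAt (fun t : ℝ => wave (p 0) (p 1)
        (z 0 + t * v 0 - wave (p 2) (p 3) (z 1 + t * v 1)))
      (waveSlope (p 0) (p 1) (z 0 - wave (p 2) (p 3) (z 1)) *
        (v 0 - waveSlope (p 2) (p 3) (z 1) * v 1)) 0 := by
    refine HasDerivAt.comp (h₂ := wave (p 0) (p 1))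
      (h := fun t : ℝ => z 0 + t * v 0 - wave (p 2) (p 3) (z 1 + t * v 1)) 0 ?_ hx
    simpa using hasDerivAt_wave (p 0) (p 1) (z 0 - wave (p 2) (p 3) (z 1))
  have hy := (hline 1).sub hw'
  have h1 : HasDerivAt (fun t : ℝ => unshear p (z + t • v))
      ![v 0 - waveSlope (p 2) (p 3) (z 1) * v 1,
        v 1 - waveSlope (p 0) (p 1) (z 0 - wave (p 2) (p 3) (z 1)) *
          (v 0 - waveSlope (p 2) (p 3) (z 1) * v 1)] 0 := by
    rw [hasDerivAt_pi]
    intro i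
    fin_cases i
    · exact hx
    · exact hy
  have h2 : HasDerivAt (fun t : ℝ => unshear p (z + t • v)) (fderiv ℝ (unshear p) z v) 0 := by
    have hl : HasDerivAt (fun t : ℝ => z + t • v) v 0 := by
      simpa using ((hasDerivAt_id (0 : ℝ)).smul_const v).const_add z
    have hd := ((contDiff_unshear (n := 1) p).differentiable one_ne_zero
      (z + (0 : ℝ) • v)).hasFDerivAt.comp_hasDerivAt 0 hl
    rw [zero_smul, add_zero] at hd
    exact hd
  exact h2.unique h1

end Shears

section Diffeo

theorem proj_eq_proj_of_add_int {F : Plane → Plane}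
    (hF : ∀ (z : Plane) (m : Fin 2 → ℤ), F (z + fun i => (m i : ℝ)) = F z + fun i => (m i : ℝ))
    {z w : Plane} (h : proj z = proj w) : proj (F z) = proj (F w) := by
  choose m hm using proj_eq_proj_iff.1 h
  have hw : w = z + fun i => (m i : ℝ) := funext hm
  rw [hw, hF]
  exact proj_eq_proj_iff.2 fun i => ⟨m i, rfl⟩

/-- The map of the torus induced by a map of the plane. -/
noncomputable def descend (F : Plane → Plane) (x : Torus) : Torus :=
  proj (F (Function.surjInv proj_surjective x))

theorem isLift_descend {F : Plane → Plane}
    (hF : ∀ (z : Plane) (m : Fin 2 → ℤ), F (z + fun i => (m i : ℝ)) = F z + fun i => (m i : ℝ)) :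
    IsLift F (descend F) := fun z =>
  proj_eq_proj_of_add_int hF (Function.surjInv_eq proj_surjective (proj z)).symm

/-- The diffeomorphism of the torus with lift `unshear p`. -/
noncomputable def shearDiffeo (r : ℕ) (p : Fin 4 → ℝ) : Diffeo r where
  toFun := descend (unshear p)
  invFun := descend (shear p)
  left_inv x := by
    obtain ⟨z, rfl⟩ := proj_surjective x
    rw [← isLift_descend (unshear_add_int p), ← isLift_descend (shear_add_int p), shear_unshear]
  right_inv x := by
    obtain ⟨z, rfl⟩ := proj_surjective x
    rw [← isLift_descend (shear_add_int p), ← isLift_descend (unshear_add_int p), unshear_shear]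
  isCr_toFun := ⟨unshear p, contDiff_unshear p, isLift_descend (unshear_add_int p)⟩
  isCr_invFun := ⟨shear p, contDiff_shear p, isLift_descend (shear_add_int p)⟩

theorem exists_int_add_mem_Icc (z : Plane) :
    ∃ m : Fin 2 → ℤ, (z + fun i => (m i : ℝ)) ∈ Icc (0 : Plane) 1 := by
  refine ⟨fun i => -⌊z i⌋, fun i => ?_, fun i => ?_⟩
  · have := Int.floor_le (z i)
    simp only [Pi.zero_apply, Pi.add_apply, Int.cast_neg]
    linarith
  · have := Int.lt_floor_add_one (z i)
    simp only [Pi.one_apply, Pi.add_apply, Int.cast_neg]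
    linarith

theorem contDiff_iteratedFDeriv_param {E F G : Type*} [NormedAddCommGroup E] [NormedSpace ℝ E]
    [NormedAddCommGroup F] [NormedSpace ℝ F] [NormedAddCommGroup G] [NormedSpace ℝ G]
    {f : E → F → G} (hf : ∀ n : ℕ, ContDiff ℝ n (Function.uncurry f)) (k n : ℕ) :
    ContDiff ℝ n (fun x : E × F => iteratedFDeriv ℝ k (f x.1) x.2) := by
  induction k generalizing n with
  | zero =>
    simp only [iteratedFDeriv_zero_eq_comp]
    exact (continuousMultilinearCurryFin0 ℝ F G).symm.contDiff.comp (hf n)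
  | succ k ih =>
    simp only [iteratedFDeriv_succ_eq_comp_left]
    refine ContDiff.comp (LinearIsometryEquiv.contDiff (𝕜 := ℝ) (E := F →L[ℝ] F [×k]→L[ℝ] G)
      (F := F [×(k + 1)]→L[ℝ] G) _) ?_
    refine ContDiff.fderiv (m := ((n + 1 : ℕ) : WithTop ℕ∞))
      (f := fun x : E × F => iteratedFDeriv ℝ k (f x.1)) (g := Prod.snd) ?_ contDiff_snd (by simp)
    exact (ih (n + 1)).comp ((contDiff_fst.comp contDiff_fst).prodMk contDiff_snd)

theorem eventually_isCloseToId_shearDiffeo (r : ℕ) {ε : ℝ} (hε : 0 < ε) :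
    ∀ᶠ p in 𝓝 (0 : Fin 4 → ℝ), (shearDiffeo r p).IsCloseToId ε := by
  have key : ∀ k : ℕ, ∀ᶠ p in 𝓝 (0 : Fin 4 → ℝ), ∀ z ∈ Icc (0 : Plane) 1,
      ‖iteratedFDeriv ℝ k (fun y => unshear p y - y) z‖ < ε := by
    intro k
    refine isCompact_Icc.eventually_forall_of_forall_eventually fun z _ => ?_
    have hc := (contDiff_iteratedFDeriv_param (f := fun (p : Fin 4 → ℝ) y => unshear p y - y)
      (fun n => contDiff_unshear_uncurry.sub contDiff_snd) k 0).continuous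
    refine hc.norm.continuousAt.eventually_lt_const ?_
    have h0 : (fun y : Plane => unshear 0 y - y) = fun _ => 0 := by
      funext y
      ext i
      fin_cases i <;> simp [unshear, wave_zero]
    simp only [h0, iteratedFDeriv_fun_zero]
    simpa using hε
  have hall : ∀ᶠ p in 𝓝 (0 : Fin 4 → ℝ), ∀ k ∈ Finset.range (r + 1), ∀ z ∈ Icc (0 : Plane) 1,
      ‖iteratedFDeriv ℝ k (fun y => unshear p y - y) z‖ < ε :=
    (eventually_all_finset _).2 fun k _ => key k
  filter_upwards [hall] with p hp
  refine ⟨unshear p, contDiff_unshear p, isLift_descend (unshear_add_int p), fun k hk z => ?_⟩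
  obtain ⟨m, hm⟩ := exists_int_add_mem_Icc z
  have hper : (fun y : Plane => unshear p (y + fun i => (m i : ℝ)) - (y + fun i => (m i : ℝ))) =
      fun y => unshear p y - y := by
    funext y
    rw [unshear_add_int]
    abel
  have := hp k (Finset.mem_range_succ_iff.2 hk) _ hm
  rwa [← iteratedFDeriv_comp_add_right k (fun i => (m i : ℝ)) z, hper] at this

end Diffeo

section Defect

/-- The determinant of a unit vector of angle `θ` at `shear p z` and of the image under the
differential of `shear p` of a unit vector of angle `φ` at `z`. -/
noncomputable def defect (θ φ : Plane → ℝ) (x : Plane × (Fin 4 → ℝ)) : ℝ :=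
  Real.cos (θ (shear x.2 x.1)) *
      (Real.sin (φ x.1) + waveSlope (x.2 0) (x.2 1) (x.1 0) * Real.cos (φ x.1)) -
    Real.sin (θ (shear x.2 x.1)) *
      (Real.cos (φ x.1) +
        waveSlope (x.2 2) (x.2 3) (x.1 1 + wave (x.2 0) (x.2 1) (x.1 0)) *
          (Real.sin (φ x.1) + waveSlope (x.2 0) (x.2 1) (x.1 0) * Real.cos (φ x.1)))

theorem contDiff_defect {θ φ : Plane → ℝ} (hθ : ContDiff ℝ 1 θ) (hφ : ContDiff ℝ 1 φ) :
    ContDiff ℝ 1 (defect θ φ) := by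
  have h1 := hθ.comp contDiff_shear_uncurry
  have h2 := hφ.comp (contDiff_fst (E := Plane) (F := Fin 4 → ℝ))
  have h3 := h1.cos
  have h4 := h1.sin
  simp only [Function.comp_def] at h2 h3 h4
  unfold defect wave waveSlope
  exact (h3.mul (by fun_prop)).sub (h4.mul (by fun_prop))

theorem defect_eq_zero_of_eq_pushforward {r : ℕ} (hr : r ≠ 0) {θ φ : Plane → ℝ}
    {V W : Torus → ℙ ℝ Plane} (hV : ∀ z, V (proj z) = lineOfAngle (θ z))
    (hW : ∀ z, W (proj z) = lineOfAngle (φ z)) {p : Fin 4 → ℝ} {z : Plane}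
    (h : W (proj z) = (shearDiffeo r p).pushforward hr V (proj z)) : defect θ φ (z, p) = 0 := by
  have hinv : (shearDiffeo r p).invFun (proj z) = proj (shear p z) :=
    (isLift_descend (shear_add_int p) z).symm
  have hder : (shearDiffeo r p).deriv (proj (shear p z)) = fderiv ℝ (unshear p) (shear p z) :=
    Diffeo.deriv_eq _ (contDiff_unshear (n := 0) p).continuous
      (isLift_descend (unshear_add_int p)) _
  simp only [Diffeo.pushforward, hW, hinv, hV] at h
  rw [lineOfAngle, lineOfAngle, Projectivization.map_mk, Projectivization.mk_eq_mk_iff] at h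
  obtain ⟨a, ha⟩ := h
  rw [ContinuousLinearMap.coe_coe, hder, fderiv_unshear_apply] at ha
  have h0 := congrFun ha 0
  have h1 := congrFun ha 1
  have hx : shear p z 0 - wave (p 2) (p 3) (shear p z 1) = z 0 := by simp [shear]
  have hy : shear p z 1 = z 1 + wave (p 0) (p 1) (z 0) := by simp [shear]
  simp only [Pi.smul_apply, Units.smul_def, smul_eq_mul, Matrix.cons_val_zero,
    Matrix.cons_val_one, hx] at h0 h1
  simp only [hy] at h0 h1
  simp only [defect]
  rw [← h0, ← h1]
  ring

theorem fderiv_defect_single (θ φ : Plane → ℝ) (hθ : ContDiff ℝ 1 θ) (hφ : ContDiff ℝ 1 φ)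
    (z : Plane) (j : Fin 4) {g : ℝ → ℝ} {d : ℝ} (hg : HasDerivAt g d 0)
    (h : ∀ t, defect θ φ (z, Pi.single j t) = g t) :
    fderiv ℝ (defect θ φ) (z, 0) (0, Pi.single j 1) = d := by
  have hl : HasDerivAt (fun t : ℝ => (z, (Pi.single j t : Fin 4 → ℝ))) (0, Pi.single j 1) 0 := by
    refine (hasDerivAt_const _ _).prodMk ?_
    rw [hasDerivAt_pi]
    intro i
    rcases eq_or_ne i j with rfl | hij
    · simpa using hasDerivAt_id' (0 : ℝ)
    · simpa [hij] using hasDerivAt_const (0 : ℝ) (0 : ℝ)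
  have hd := ((contDiff_defect hθ hφ).differentiable one_ne_zero
    (z, (Pi.single j (0 : ℝ) : Fin 4 → ℝ))).hasFDerivAt.comp_hasDerivAt 0 hl
  rw [Pi.single_zero] at hd
  refine hd.unique ?_
  have : defect θ φ ∘ (fun t : ℝ => (z, (Pi.single j t : Fin 4 → ℝ))) = g := funext h
  rwa [this]

theorem hasDerivAt_along {θ : Plane → ℝ} (hθ : ContDiff ℝ 1 θ) (z v : Plane) :
    HasDerivAt (fun t : ℝ => θ (z + t • v)) (fderiv ℝ θ z v) 0 := by
  have hl : HasDerivAt (fun t : ℝ => z + t • v) v 0 := by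
    simpa using ((hasDerivAt_id (0 : ℝ)).smul_const v).const_add z
  have hd := (hθ.differentiable one_ne_zero (z + (0 : ℝ) • v)).hasFDerivAt.comp_hasDerivAt 0 hl
  rw [zero_smul, add_zero] at hd
  exact hd

theorem fderiv_defect_vertical {θ φ : Plane → ℝ} (hθ : ContDiff ℝ 1 θ) (hφ : ContDiff ℝ 1 φ)
    (z : Plane) (j : Fin 4) {σ τ : ℝ}
    (hs : ∀ t, shear (Pi.single j t) z = z + t • ![0, σ])
    (ha : ∀ t, waveSlope ((Pi.single j t : Fin 4 → ℝ) 0) ((Pi.single j t : Fin 4 → ℝ) 1) (z 0) =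
      t * τ)
    (hb : ∀ t, (Pi.single j t : Fin 4 → ℝ) 2 = 0 ∧ (Pi.single j t : Fin 4 → ℝ) 3 = 0) :
    fderiv ℝ (defect θ φ) (z, 0) (0, Pi.single j 1) =
      -(fderiv ℝ θ z ![0, 1] * σ) *
          (Real.sin (θ z) * Real.sin (φ z) + Real.cos (θ z) * Real.cos (φ z)) +
        τ * (Real.cos (θ z) * Real.cos (φ z)) := by
  have hv : fderiv ℝ θ z ![0, σ] = σ * fderiv ℝ θ z ![0, 1] := by
    rw [← smul_eq_mul, ← map_smul]
    simp
  have hθ' := hasDerivAt_along hθ z ![0, σ]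
  have hlin : HasDerivAt (fun t : ℝ => Real.sin (φ z) + t * τ * Real.cos (φ z))
      (τ * Real.cos (φ z)) 0 := by
    simpa using (((hasDerivAt_id (0 : ℝ)).mul_const τ).mul_const
      (Real.cos (φ z))).const_add (Real.sin (φ z))
  refine (fderiv_defect_single θ φ hθ hφ z j
    ((hθ'.cos.mul hlin).sub (hθ'.sin.mul_const (Real.cos (φ z)))) fun t => ?_).trans ?_
  · simp [defect, hs, ha, (hb t).1, (hb t).2, waveSlope_zero]
  · rw [hv]
    simp only [zero_smul, add_zero, zero_mul]
    ring

theorem fderiv_defect_horizontal {θ φ : Plane → ℝ} (hθ : ContDiff ℝ 1 θ) (hφ : ContDiff ℝ 1 φ)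
    (z : Plane) (j : Fin 4) {σ τ : ℝ}
    (hs : ∀ t, shear (Pi.single j t) z = z + t • ![σ, 0])
    (ha : ∀ t, waveSlope ((Pi.single j t : Fin 4 → ℝ) 2) ((Pi.single j t : Fin 4 → ℝ) 3) (z 1) =
      t * τ)
    (hb : ∀ t, (Pi.single j t : Fin 4 → ℝ) 0 = 0 ∧ (Pi.single j t : Fin 4 → ℝ) 1 = 0) :
    fderiv ℝ (defect θ φ) (z, 0) (0, Pi.single j 1) =
      -(fderiv ℝ θ z ![1, 0] * σ) *
          (Real.sin (θ z) * Real.sin (φ z) + Real.cos (θ z) * Real.cos (φ z)) -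
        τ * (Real.sin (θ z) * Real.sin (φ z)) := by
  have hv : fderiv ℝ θ z ![σ, 0] = σ * fderiv ℝ θ z ![1, 0] := by
    rw [← smul_eq_mul, ← map_smul]
    simp
  have hθ' := hasDerivAt_along hθ z ![σ, 0]
  have hlin : HasDerivAt (fun t : ℝ => Real.cos (φ z) + t * τ * Real.sin (φ z))
      (τ * Real.sin (φ z)) 0 := by
    simpa using (((hasDerivAt_id (0 : ℝ)).mul_const τ).mul_const
      (Real.sin (φ z))).const_add (Real.cos (φ z))
  refine (fderiv_defect_single θ φ hθ hφ z j
    ((hθ'.cos.mul_const (Real.sin (φ z))).sub (hθ'.sin.mul hlin)) fun t => ?_).trans ?_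
  · simp [defect, hs, ha, (hb t).1, (hb t).2, waveSlope_zero, wave_zero]
  · rw [hv]
    simp only [zero_smul, add_zero, zero_mul]
    ring

theorem eq_zero_of_rotated_eq_zero {A B t : ℝ}
    (h1 : -(A * Real.sin t) + 2 * Real.pi * Real.cos t * B = 0)
    (h2 : -(A * Real.cos t) - 2 * Real.pi * Real.sin t * B = 0) : B = 0 := by
  have h : 2 * Real.pi * B = 0 := by
    linear_combination Real.cos t * h1 - Real.sin t * h2 -
      2 * Real.pi * B * Real.sin_sq_add_cos_sq t
  simpa [Real.pi_ne_zero] using h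

theorem exists_fderiv_defect_ne_zero {θ φ : Plane → ℝ} (hθ : ContDiff ℝ 1 θ)
    (hφ : ContDiff ℝ 1 φ) (z : Plane) (h : defect θ φ (z, 0) = 0) :
    ∃ j, fderiv ℝ (defect θ φ) (z, 0) (0, Pi.single j 1) ≠ 0 := by
  by_contra! hall
  have h0 := fderiv_defect_vertical hθ hφ z 0 (σ := Real.sin (2 * Real.pi * z 0))
    (τ := 2 * Real.pi * Real.cos (2 * Real.pi * z 0))
    (fun t => by ext i; fin_cases i <;> simp [shear, wave])
    (fun t => by simp [waveSlope]; ring) (fun t => by simp)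
  have h1 := fderiv_defect_vertical hθ hφ z 1 (σ := Real.cos (2 * Real.pi * z 0))
    (τ := -(2 * Real.pi * Real.sin (2 * Real.pi * z 0)))
    (fun t => by ext i; fin_cases i <;> simp [shear, wave])
    (fun t => by simp [waveSlope]; ring) (fun t => by simp)
  have h2 := fderiv_defect_horizontal hθ hφ z 2 (σ := Real.sin (2 * Real.pi * z 1))
    (τ := 2 * Real.pi * Real.cos (2 * Real.pi * z 1))
    (fun t => by ext i; fin_cases i <;> simp [shear, wave])
    (fun t => by simp [waveSlope]; ring) (fun t => by simp)
  have h3 := fderiv_defect_horizontal hθ hφ z 3 (σ := Real.cos (2 * Real.pi * z 1))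
    (τ := -(2 * Real.pi * Real.sin (2 * Real.pi * z 1)))
    (fun t => by ext i; fin_cases i <;> simp [shear, wave])
    (fun t => by simp [waveSlope]; ring) (fun t => by simp)
  rw [hall] at h0 h1 h2 h3
  set m := Real.sin (θ z) * Real.sin (φ z) + Real.cos (θ z) * Real.cos (φ z) with hm
  have hc : Real.cos (θ z) * Real.cos (φ z) = 0 :=
    eq_zero_of_rotated_eq_zero (A := fderiv ℝ θ z ![0, 1] * m) (t := 2 * Real.pi * z 0)
      (by linear_combination -h0) (by linear_combination -h1)
  have hs : -(Real.sin (θ z) * Real.sin (φ z)) = 0 :=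
    eq_zero_of_rotated_eq_zero (A := fderiv ℝ θ z ![1, 0] * m) (t := 2 * Real.pi * z 1)
      (by linear_combination -h2) (by linear_combination -h3)
  have hz : shear 0 z = z := by ext i; fin_cases i <;> simp [shear, wave_zero]
  have hdet : Real.cos (θ z) * Real.sin (φ z) - Real.sin (θ z) * Real.cos (φ z) = 0 := by
    simpa [defect, hz, waveSlope_zero, wave_zero] using h
  have hm0 : m = 0 := by linear_combination hm + hc - hs
  have hθ1 := Real.sin_sq_add_cos_sq (θ z)
  have hφ1 := Real.sin_sq_add_cos_sq (φ z)
  have : m ^ 2 + (Real.cos (θ z) * Real.sin (φ z) - Real.sin (θ z) * Real.cos (φ z)) ^ 2 = 1 := by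
    rw [hm]
    linear_combination (Real.sin (φ z) ^ 2 + Real.cos (φ z) ^ 2) * hθ1 + hφ1
  rw [hm0, hdet] at this
  norm_num at this

end Defect

end TorusLineFields

theorem proposition4p1 (r : ℕ) (hr : 3 ≤ r) (α : NNReal) (hα : 0 < α) (hα' : α ≤ 1)
    (W V₁ V₂ V₃ : TorusLineFields.Torus → Projectivization ℝ TorusLineFields.Plane)
    (hW : TorusLineFields.IsC1HolderLineField α W)
    (hV₁ : TorusLineFields.IsC1HolderLineField α V₁)
    (hV₂ : TorusLineFields.IsC1HolderLineField α V₂)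
    (hV₃ : TorusLineFields.IsC1HolderLineField α V₃) :
    ∀ ε : ℝ, 0 < ε → ∃ h₁ h₂ h₃ : TorusLineFields.Diffeo r,
      h₁.IsCloseToId ε ∧ h₂.IsCloseToId ε ∧ h₃.IsCloseToId ε ∧
      ∀ x : TorusLineFields.Torus,
        ({W x} ∩ {h₁.pushforward (Nat.ne_zero_of_lt hr) V₁ x} ∩ {h₂.pushforward (Nat.ne_zero_of_lt hr) V₂ x} ∩
          {h₃.pushforward (Nat.ne_zero_of_lt hr) V₃ x} :
            Set (Projectivization ℝ TorusLineFields.Plane)) = ∅ := by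
  open TorusLineFields in
  intro ε hε
  obtain ⟨φ, hφ, -, hWφ⟩ := hW
  obtain ⟨θ₁, hθ₁, -, hVθ₁⟩ := hV₁
  obtain ⟨θ₂, hθ₂, -, hVθ₂⟩ := hV₂
  obtain ⟨θ₃, hθ₃, -, hVθ₃⟩ := hV₃
  obtain ⟨ρ, hρ, hclose⟩ := Metric.eventually_nhds_iff.1 (eventually_isCloseToId_shearDiffeo r hε)
  have hθ : ∀ i, ContDiff ℝ 1 ((![θ₁, θ₂, θ₃] : Fin 3 → Plane → ℝ) i) := by
    intro i
    fin_cases i <;> assumption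
  obtain ⟨p, hpρ, hp⟩ := exists_small_params_no_common_zero
    (f := fun i => defect ((![θ₁, θ₂, θ₃] : Fin 3 → Plane → ℝ) i) φ)
    (fun i => contDiff_defect (hθ i) hφ)
    (fun i z _ h => exists_fderiv_defect_ne_zero (hθ i) hφ z h) hρ
  have hpc : ∀ i, (shearDiffeo r (p i)).IsCloseToId ε := fun i => hclose (by simpa using hpρ i)
  refine ⟨shearDiffeo r (p 0), shearDiffeo r (p 1), shearDiffeo r (p 2), hpc 0, hpc 1, hpc 2,
    fun x => Set.eq_empty_iff_forall_notMem.2 ?_⟩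
  rintro ℓ ⟨⟨⟨hℓ, hℓ₁⟩, hℓ₂⟩, hℓ₃⟩
  rw [Set.mem_singleton_iff] at hℓ hℓ₁ hℓ₂ hℓ₃
  subst hℓ
  obtain ⟨y, rfl⟩ := proj_surjective x
  obtain ⟨m, hm⟩ := exists_int_add_mem_Icc y
  have hy : proj y = proj (y + fun i => (m i : ℝ)) := proj_eq_proj_iff.2 fun i => ⟨m i, rfl⟩
  rw [hy] at hℓ₁ hℓ₂ hℓ₃
  obtain ⟨i, hi⟩ := hp _ hm
  fin_cases i
  · exact hi (defect_eq_zero_of_eq_pushforward _ hVθ₁ hWφ hℓ₁)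
  · exact hi (defect_eq_zero_of_eq_pushforward _ hVθ₂ hWφ hℓ₂)
  · exact hi (defect_eq_zero_of_eq_pushforward _ hVθ₃ hWφ hℓ₃)
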